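/- Let $G=(V,E)$ be a finite loopless multigraph with $n=|V|$ vertices, let $\mu(G)$ be the size of a maximum matching of $G$, let $\varepsilon\in(0,1)$, and suppose that $\mu(G)\ge \varepsilon n/16$. Put $\alpha_\varepsilon=\log_2 n\cdot 2^{60/\varepsilon^2}$ and $\rho_\varepsilon=\log_2 n\cdot 2^{40/\varepsilon^2}$. Let $\kappa:E\to\mathbb R_{\ge 0}$ be a capacity function with $\kappa(e)\le 1/\alpha_\varepsilon$ for all $e\in E$. For $u,v\in V$ let $D(u,v)$ be the set of edges between $u$ and $v$, and let $\kappa(D(u,v))$ be their total capacity. Let $E_L$ be the set of all edges $e\in E$ such that $\kappa(D(u,v))\le 1/\alpha_\varepsilon^2$, where $u,v$ are the endpoints of $e$. Let $\kappa^+(e)=\alpha_\varepsilon\,\kappa(e)$ for $e\in E_L$ and $\kappa^+(e)=\kappa(e)$ for $e\in E\setminus E_L$. For a subgraph $H$ of $G$ let $\mu(H,\kappa^+)$ be the maximum of $\sum_{e\in E(H)}x(e)$ over all $x:E(H)\to\mathbb R_{\ge 0}$ such that $\sum_{e\ni v}x(e)\le 1$ for every vertex $v$ of $H$, $x(e)\le\kappa^+(e)$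 for every edge $e$ of $H$, and $\sum_{e\in E(H[B])}x(e)\le\frac{|B|-1}{2}$ for every odd-sized $B\subseteq V(H)$. Let $G_s$ be the random subgraph of $G$ with vertex set $V$ that contains each edge $e\in E$ independently with probability $\kappa(e)\rho_\varepsilon$. Then, with high probability, namely with probability at least $\max\{1-e^{-\mu(G)},\,1-n^{-2}\}$ (at least $1-e^{-\mu(G)}$ if $n=0$), simultaneously for all $W\subseteq V$, $$\mu\bigl(G_s[W]\cap E_L\bigr)\;\le\;\mu\bigl(G[W]\cap E_L,\ \kappa^+\bigr)+2\varepsilon\,\mu(G).$$ -/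

import Mathlib

/-! Multigraphs are Mathlib's `Graph V E` (vertex labels in `V`, edge labels in `E`, parallel edges
allowed). `G.restrict F` keeps all vertices and the edges in `F`; `G.induce W` is `G[W]`. -/

section

variable {V E : Type*}

namespace Graph

/-- A set of edges is an (integral) matching if distinct edges of it share no endpoint. -/
def IsMatching (G : Graph V E) (M : Finset E) : Prop :=
  (M : Set E) ⊆ G.edgeSet ∧
    ∀ e ∈ M, ∀ f ∈ M, ∀ v : V, G.Inc e v → G.Inc f v → e = f

/-- `μ(G)`: the maximum number of edges in a matching of `G`. -/
noncomputable def matchingNumber [Fintype E] (G : Graph V E) : ℕ :=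
  sSup {k : ℕ | ∃ M : Finset E, G.IsMatching M ∧ M.card = k}

open scoped Classical in
/-- Fractional matchings: nonnegative weights on the edges, of total at most `1` at each vertex. -/
structure IsFractionalMatching [Fintype E] (G : Graph V E) (x : E → ℝ) : Prop where
  nonneg : ∀ e ∈ G.edgeSet, 0 ≤ x e
  sum_le_one : ∀ v ∈ G.vertexSet, ∑ e with G.Inc e v, x e ≤ 1

/-- `x` obeys the capacity function `κ`. -/
def Obeys (G : Graph V E) (κ x : E → ℝ) : Prop := ∀ e ∈ G.edgeSet, x e ≤ κ e

open scoped Classical in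
/-- The odd set constraints: `x(G[B]) ≤ (|B| - 1) / 2` for all odd-sized sets `B` of vertices. -/
def OddSetConstraints [Fintype E] (G : Graph V E) (x : E → ℝ) : Prop :=
  ∀ B : Finset V, (B : Set V) ⊆ G.vertexSet → Odd B.card →
    ∑ e with e ∈ (G.induce (B : Set V)).edgeSet, x e ≤ ((B.card : ℝ) - 1) / 2

open scoped Classical in
/-- `μ(G, κ)`: the maximum value of a fractional matching of `G` obeying the capacities `κ` and
the odd set constraints. -/
noncomputable def capMatchingNumber [Fintype E] (G : Graph V E) (κ : E → ℝ) : ℝ :=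
  sSup {r : ℝ | ∃ x : E → ℝ, G.IsFractionalMatching x ∧ G.Obeys κ x ∧ G.OddSetConstraints x ∧
    ∑ e with e ∈ G.edgeSet, x e = r}

/-- `n`, the number of vertices. -/
noncomputable def order (G : Graph V E) : ℕ := G.vertexSet.ncard

/-- `α_ε = log n · 2 ^ (60 / ε²)`. -/
noncomputable def alphaParam (G : Graph V E) (ε : ℝ) : ℝ :=
  Real.logb 2 (G.order : ℝ) * (2 : ℝ) ^ (60 / ε ^ 2)

/-- `ρ_ε = log n · 2 ^ (40 / ε²)`. -/
noncomputable def rhoParam (G : Graph V E) (ε : ℝ) : ℝ :=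
  Real.logb 2 (G.order : ℝ) * (2 : ℝ) ^ (40 / ε ^ 2)

open scoped Classical in
/-- `κ(D(u, v))`: the total capacity of all edges between `u` and `v`. -/
noncomputable def pairCapacity [Fintype E] (G : Graph V E) (κ : E → ℝ) (u v : V) : ℝ :=
  ∑ e with G.IsLink e u v, κ e

/-- `E_L(G, κ)`: the edges between pairs `u, v` with `κ(D(u, v)) ≤ 1 / α_ε²`. -/
def lowEdges [Fintype E] (G : Graph V E) (κ : E → ℝ) (ε : ℝ) : Set E :=
  {e | ∃ u v : V, G.IsLink e u v ∧ G.pairCapacity κ u v ≤ 1 / G.alphaParam ε ^ 2}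

open scoped Classical in
/-- `κ⁺`: the capacities of the edges in `E_L(G, κ)` are multiplied by `α_ε`. -/
noncomputable def capPlus [Fintype E] (G : Graph V E) (κ : E → ℝ) (ε : ℝ) (e : E) : ℝ :=
  if e ∈ G.lowEdges κ ε then κ e * G.alphaParam ε else κ e

/-- The probability with which an edge `e` is sampled: `κ(e) · ρ_ε`, truncated to `[0, 1]`
(if `0 ≤ κ(e) ≤ 1 / α_ε` then `0 ≤ κ(e) · ρ_ε ≤ 1`, so that the truncation is void). -/
noncomputable def samplingProb (G : Graph V E) (κ : E → ℝ) (ε : ℝ) (e : E) : unitInterval :=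
  Set.projIcc (0 : ℝ) 1 zero_le_one (κ e * G.rhoParam ε)

/-- The law of independent coin flips `ω`, one for each edge; `ω e = true` means that `e` is
sampled, and has probability `G.samplingProb κ ε e`. -/
noncomputable def samplingMeasure [Fintype E] (G : Graph V E) (κ : E → ℝ) (ε : ℝ) :
    MeasureTheory.Measure (E → Bool) :=
  MeasureTheory.Measure.pi fun e =>
    ProbabilityTheory.bernoulliMeasure true false (G.samplingProb κ ε e)

/-- `G_s`: the subgraph of `G` formed by the sampled edges. -/
def sampled (G : Graph V E) (ω : E → Bool) : Graph V E := G.restrict {e | ω e = true}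

end Graph

end

/-! Fix `W` and let H = G[W] ∩ E_L. Relaxing only the capacities κ⁺ in the linear program over the
convex hull of the matchings of H gives prices z in [0, 1] with ∑ z κ⁺ ≤ T and |M| ≤ T + z(M) for
every matching M, where T ≤ μ(H, κ⁺) + ε μ(G) / 10 (`exists_prices`). A sampled matching can thus
exceed T only by the total price of the sampled edges. On E_L, κ⁺ = α κ, so this price has mean at
most (ρ/α) T = 2^(-20/ε²) T, and by a Chernoff bound (`measureReal_pi_bernoulli_le_sum`) it reaches
19/10 ε μ(G) with probability exponentially small in μ(G)/ε. As n ≤ 16 μ(G)/ε, this survives a union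
bound over the sets `W` (`two_pow_mul_exp_le`). -/

/-! ### Lagrangian duality by separation -/

/-- Linear programming duality for the capacity constraints: if every point of the convex hull of
`S` that obeys the capacities `c` has total weight less than `T`, then there are prices `z`
witnessing this bound. -/
theorem exists_prices_of_convexHull {ι : Type*} [Fintype ι] {S : Set (ι → ℝ)} (hS : S.Finite)
    (h0 : 0 ∈ S) {c : ι → ℝ} (hc : 0 ≤ c) {T : ℝ}
    (hT : ∀ x ∈ convexHull ℝ S, x ≤ c → ∑ i, x i < T) :
    ∃ z : ι → ℝ, 0 ≤ z ∧ ∀ x ∈ S, ∑ i, x i + ∑ i, z i * c i ≤ T + ∑ i, z i * x i := by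
  classical
  have hTpos : 0 < T := by simpa using hT 0 (subset_convexHull ℝ S h0) hc
  let g : (ι → ℝ) →ₗ[ℝ] (ι → ℝ) × ℝ :=
    LinearMap.prod LinearMap.id (∑ i, LinearMap.proj i)
  have hg : ∀ x, g x = (x, ∑ i, x i) := fun x => by simp [g]
  have hgc : Continuous g := g.continuous_of_finiteDimensional
  -- A point of the image of `g` in `D` would be a feasible `x` of total at least `T`.
  let D : Set ((ι → ℝ) × ℝ) := Set.Iic c ×ˢ Set.Ici T
  obtain ⟨f, u, v, hfu, huv, hfv⟩ := geometric_hahn_banach_compact_closed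
    (s := g '' convexHull ℝ S) (t := D)
    ((convex_convexHull ℝ S).linear_image g) ((Set.Finite.isCompact_convexHull (𝕜 := ℝ) hS).image hgc)
    ((convex_Iic c).prod (convex_Ici T)) (isClosed_Iic.prod isClosed_Ici) (by
      rw [Set.disjoint_left]
      rintro _ ⟨x, hx, rfl⟩ ⟨h1, h2⟩
      rw [hg] at h1 h2
      exact absurd (hT x hx h1) (not_lt.2 h2))
  set s : ℝ := f (0, 1) with hs
  set z : ι → ℝ := fun i => - f (Pi.single i 1, 0) with hz
  have hf : ∀ a t, f (a, t) = t * s - ∑ i, z i * a i := by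
    intro a t
    have h1 : (a, t) = (∑ i, a i • ((Pi.single i 1 : ι → ℝ), (0 : ℝ))) + t • ((0 : ι → ℝ), (1 : ℝ)) := by
      ext j
      · simp [Prod.fst_sum, Finset.sum_apply, Pi.single_apply]
      · simp [Prod.snd_sum]
    rw [h1, map_add, map_sum]
    simp only [map_smul, smul_eq_mul, hz, hs, neg_mul, Finset.sum_neg_distrib]
    simp only [mul_comm]
    ring
  have hbase : v < T * s - ∑ i, z i * c i := by
    rw [← hf]; exact hfv _ ⟨Set.mem_Iic.2 le_rfl, Set.mem_Ici.2 le_rfl⟩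
  have hz0 : 0 ≤ z := by
    intro i
    by_contra! hneg
    replace hneg : z i < 0 := hneg
    have hne := hneg.ne
    -- `D` is unbounded in this direction; this step length brings `f` down to exactly `v`, against
    -- strict separation.
    set r := (T * s - ∑ i, z i * c i - v) / (- z i) with hr
    have hr0 : 0 ≤ r := div_nonneg (by linarith) (by linarith)
    have := hfv (c - Pi.single i r, T) ⟨by
      rw [Set.mem_Iic]; simpa using hr0, Set.mem_Ici.2 le_rfl⟩
    rw [hf] at this
    have h2 : ∑ j, z j * (c - Pi.single i r : ι → ℝ) j = ∑ j, z j * c j - z i * r := by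
      simp [mul_sub, Finset.sum_sub_distrib, Pi.single_apply]
    have h3 : z i * r = -(T * s - ∑ i, z i * c i - v) := by
      rw [hr, div_neg]; field_simp
    linarith
  have hs0 : 0 ≤ s := by
    by_contra! hneg
    have hne := hneg.ne
    set r := (T * s - ∑ i, z i * c i - v) / (- s) with hr
    have hr0 : 0 ≤ r := div_nonneg (by linarith) (by linarith)
    have := hfv (c, T + r) ⟨Set.mem_Iic.2 le_rfl, Set.mem_Ici.2 (by linarith)⟩
    rw [hf] at this
    have h3 : r * s = -(T * s - ∑ i, z i * c i - v) := by
      rw [hr, div_neg]; field_simp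
    linarith
  have key : ∀ x ∈ S, (∑ i, x i) * s - ∑ i, z i * x i ≤ T * s - ∑ i, z i * c i := by
    intro x hx
    have := hfu (g x) ⟨x, subset_convexHull ℝ S hx, rfl⟩
    rw [hg, hf] at this
    linarith
  have hzc : 0 ≤ ∑ i, z i * c i := Finset.sum_nonneg fun i _ => mul_nonneg (hz0 i) (hc i)
  -- If `s = 0`, then `f` is 0 at `g 0` and at most 0 at `(c, T)`, so nothing is separated.
  have hspos : 0 < s := by
    have h1 := hfu (g 0) ⟨0, subset_convexHull ℝ S h0, rfl⟩
    rw [hg, hf] at h1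
    simp only [Pi.zero_apply, Finset.sum_const_zero, zero_mul, mul_zero, sub_zero] at h1
    refine hs0.lt_of_ne fun h => ?_
    rw [← h] at hbase
    linarith
  refine ⟨fun i => z i / s, fun i => div_nonneg (hz0 i) hs0, fun x hx => ?_⟩
  have h1 : ∀ y : ι → ℝ, ∑ i, z i / s * y i = (∑ i, z i * y i) / s := fun y => by
    rw [Finset.sum_div]; exact Finset.sum_congr rfl fun i _ => by ring
  rw [h1, h1, ← mul_le_mul_iff_left₀ hspos]
  have := key x hx
  field_simp
  linarith

/-! ### Matchings, their polytope and edge prices -/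

namespace Graph

variable {V E : Type*} {G H : Graph V E}

theorem IsMatching.mono {M : Finset E} (hM : H.IsMatching M) (h : H ≤ G) : G.IsMatching M := by
  refine ⟨fun e he => h.edgeSet_mono (hM.1 he), fun e he f hf v hev hfv => ?_⟩
  refine hM.2 e he f hf v ?_ ?_
  · obtain ⟨w, hw⟩ := hev
    exact ⟨w, (h.isLink_iff (hM.1 he)).2 hw⟩
  · obtain ⟨w, hw⟩ := hfv
    exact ⟨w, (h.isLink_iff (hM.1 hf)).2 hw⟩

theorem IsMatching.subset {M N : Finset E} (hM : G.IsMatching M) (h : N ⊆ M) : G.IsMatching N :=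
  ⟨fun _ he => hM.1 (h he), fun e he f hf => hM.2 e (h he) f (h hf)⟩

theorem isMatching_empty : G.IsMatching (∅ : Finset E) := by
  simp [IsMatching]

theorem IsMatching.card_filter_inc_le_one {M : Finset E} (hM : G.IsMatching M) (v : V)
    [DecidablePred fun e => G.Inc e v] : (M.filter fun e => G.Inc e v).card ≤ 1 := by
  rw [Finset.card_le_one]
  intro e he f hf
  rw [Finset.mem_filter] at he hf
  exact hM.2 e he.1 f hf.1 v he.2 hf.2

-- Double counting of incidences: by looplessness each edge inside `B` has two ends there, and no
-- vertex is used twice.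
open scoped Classical in
theorem IsMatching.two_mul_card_induce_le [G.Loopless] {M : Finset E} (hM : G.IsMatching M)
    (B : Finset V) :
    2 * (M.filter fun e => e ∈ (G.induce (B : Set V)).edgeSet).card ≤ B.card := by
  set N := M.filter fun e => e ∈ (G.induce (B : Set V)).edgeSet with hN
  have h1 : ∀ e ∈ N, 2 ≤ (B.filter fun v => G.Inc e v).card := by
    intro e he
    obtain ⟨u, v, huv, hu, hv⟩ := exists_isLink_of_mem_edgeSet (Finset.mem_filter.1 he).2
    have hne : u ≠ v := IsLink.ne huv
    rw [← Finset.card_pair hne]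
    refine Finset.card_le_card fun w hw => ?_
    rcases Finset.mem_insert.1 hw with rfl | hw
    · exact Finset.mem_filter.2 ⟨hu, huv.inc_left⟩
    · rw [Finset.mem_singleton.1 hw]
      exact Finset.mem_filter.2 ⟨hv, huv.inc_right⟩
  have h2 : ∀ v ∈ B, (N.filter fun e => G.Inc e v).card ≤ 1 := fun v _ =>
    (hM.subset (Finset.filter_subset _ _)).card_filter_inc_le_one v
  calc 2 * N.card = ∑ e ∈ N, 2 := by simp [mul_comm]
    _ ≤ ∑ e ∈ N, (B.filter fun v => G.Inc e v).card := Finset.sum_le_sum h1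
    _ = ∑ v ∈ B, (N.filter fun e => G.Inc e v).card :=
      Finset.sum_card_bipartiteAbove_eq_sum_card_bipartiteBelow _
    _ ≤ ∑ v ∈ B, 1 := Finset.sum_le_sum h2
    _ = B.card := by simp

/-- The indicator vectors of the matchings of `G`. -/
def matchingVectors (G : Graph V E) : Set (E → ℝ) :=
  {x | ∃ M : Finset E, G.IsMatching M ∧ x = (M : Set E).indicator 1}

theorem zero_mem_matchingVectors (G : Graph V E) : 0 ∈ G.matchingVectors :=
  ⟨∅, isMatching_empty, by ext; simp⟩

variable [Fintype E]

theorem IsMatching.card_le_matchingNumber {M : Finset E} (hM : G.IsMatching M) :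
    M.card ≤ G.matchingNumber :=
  le_csSup ⟨Fintype.card E, by rintro _ ⟨N, -, rfl⟩; exact N.card_le_univ⟩ ⟨M, hM, rfl⟩

theorem exists_isMatching_card_eq_matchingNumber (G : Graph V E) :
    ∃ M : Finset E, G.IsMatching M ∧ M.card = G.matchingNumber :=
  Nat.sSup_mem (s := {k : ℕ | ∃ M : Finset E, G.IsMatching M ∧ M.card = k})
    ⟨0, ∅, isMatching_empty, rfl⟩
    ⟨Fintype.card E, by rintro _ ⟨N, -, rfl⟩; exact N.card_le_univ⟩

theorem matchingNumber_mono (h : H ≤ G) : H.matchingNumber ≤ G.matchingNumber := by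
  obtain ⟨M, hM, hcard⟩ := H.exists_isMatching_card_eq_matchingNumber
  rw [← hcard]
  exact (hM.mono h).card_le_matchingNumber

theorem finite_matchingVectors (G : Graph V E) : G.matchingVectors.Finite :=
  (Set.finite_range fun M : Finset E => ((M : Set E).indicator 1 : E → ℝ)).subset <| by
    rintro _ ⟨M, -, rfl⟩; exact ⟨M, rfl⟩

theorem sum_mul_indicator (y : E → ℝ) (M : Finset E) :
    ∑ e, y e * (M : Set E).indicator (1 : E → ℝ) e = ∑ e ∈ M, y e := by
  classical
  simp [Set.indicator_apply]

theorem sum_filter_indicator (p : E → Prop) [DecidablePred p] (M : Finset E) :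
    ∑ e with p e, (M : Set E).indicator (1 : E → ℝ) e = (M.filter p).card := by
  classical
  simp only [Set.indicator_apply, Pi.one_apply, Finset.mem_coe, Finset.sum_boole]
  congr 2
  ext e
  simp [and_comm]

open scoped Classical in
theorem IsFractionalMatching.le_one {x : E → ℝ} (hx : G.IsFractionalMatching x) {e : E}
    (he : e ∈ G.edgeSet) : x e ≤ 1 := by
  obtain ⟨u, v, huv⟩ := exists_isLink_of_mem_edgeSet he
  refine le_trans ?_ (hx.sum_le_one u huv.left_mem)
  refine Finset.single_le_sum (f := x) (fun f hf => ?_) (Finset.mem_filter.2 ⟨Finset.mem_univ e, huv.inc_left⟩)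
  exact hx.nonneg f (Finset.mem_filter.1 hf).2.edge_mem

open scoped Classical in
theorem le_capMatchingNumber {c x : E → ℝ} (hx : G.IsFractionalMatching x) (hc : G.Obeys c x)
    (hodd : G.OddSetConstraints x) : ∑ e with e ∈ G.edgeSet, x e ≤ G.capMatchingNumber c := by
  refine le_csSup ⟨Fintype.card E, ?_⟩ ⟨x, hx, hc, hodd, rfl⟩
  rintro _ ⟨y, hy, -, -, rfl⟩
  calc ∑ e with e ∈ G.edgeSet, y e ≤ ∑ e with e ∈ G.edgeSet, (1 : ℝ) :=
        Finset.sum_le_sum fun e he => hy.le_one (Finset.mem_filter.1 he).2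
    _ ≤ ∑ e : E, (1 : ℝ) :=
        Finset.sum_le_sum_of_subset_of_nonneg (Finset.filter_subset _ _) (by simp)
    _ = Fintype.card E := by simp

/-- This is the easy half of Edmonds' matching polytope theorem; the converse is never needed. -/
theorem convexHull_matchingVectors_subset [G.Loopless] :
    convexHull ℝ G.matchingVectors ⊆
      {x | G.IsFractionalMatching x ∧ G.OddSetConstraints x ∧ (∀ e ∉ G.edgeSet, x e = 0) ∧
        ∑ e, x e ≤ G.matchingNumber} := by
  classical
  refine convexHull_min ?_ ?_
  · rintro _ ⟨M, hM, rfl⟩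
    refine ⟨⟨fun e _ => Set.indicator_nonneg (by simp) e, fun v _ => ?_⟩, fun B _ hB => ?_,
      fun e he => Set.indicator_of_notMem (fun h => he (hM.1 h)) _, ?_⟩
    · rw [sum_filter_indicator]
      exact_mod_cast hM.card_filter_inc_le_one v
    · rw [sum_filter_indicator]
      have h := hM.two_mul_card_induce_le B
      obtain ⟨k, hk⟩ := hB
      have h' : (M.filter fun e => e ∈ (G.induce (B : Set V)).edgeSet).card ≤ k := by omega
      rw [hk]
      push_cast
      have : ((M.filter fun e => e ∈ (G.induce (B : Set V)).edgeSet).card : ℝ) ≤ k := by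
        exact_mod_cast h'
      linarith
    · have := sum_mul_indicator (fun _ => (1 : ℝ)) M
      simp only [one_mul, Finset.sum_const, nsmul_eq_mul, mul_one] at this
      rw [this]
      exact_mod_cast hM.card_le_matchingNumber
  · rintro x ⟨hx, hx1, hx2, hx3⟩ y ⟨hy, hy1, hy2, hy3⟩ a b ha hb hab
    have hsum : ∀ s : Finset E, ∀ t : ℝ, ∑ e ∈ s, x e ≤ t → ∑ e ∈ s, y e ≤ t →
        ∑ e ∈ s, (a • x + b • y) e ≤ t := by
      intro s t h1 h2
      simp only [Pi.add_apply, Pi.smul_apply, smul_eq_mul, Finset.sum_add_distrib,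
        ← Finset.mul_sum]
      calc _ ≤ a * t + b * t := by gcongr
        _ = t := by rw [← add_mul, hab, one_mul]
    refine ⟨⟨fun e he => ?_, fun v hv => hsum _ _ (hx.sum_le_one v hv) (hy.sum_le_one v hv)⟩,
      fun B hB hodd => hsum _ _ (hx1 B hB hodd) (hy1 B hB hodd), fun e he => ?_,
      hsum _ _ hx3 hy3⟩
    · have := hx.nonneg e he
      have := hy.nonneg e he
      simp only [Pi.add_apply, Pi.smul_apply, smul_eq_mul]
      positivity
    · simp [hx2 e he, hy2 e he]

/-- Prices in `[0, 1]` on the edges such that every matching has at most `T` edges more than the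
total price of its edges. -/
theorem exists_prices [G.Loopless] {c : E → ℝ} (hc : ∀ e ∈ G.edgeSet, 0 ≤ c e) {T : ℝ}
    (hT : min (G.capMatchingNumber c) G.matchingNumber < T) :
    ∃ z : E → ℝ, (∀ e, 0 ≤ z e) ∧ (∀ e, z e ≤ 1) ∧ (∀ e ∉ G.edgeSet, z e = 0) ∧
      ∑ e, z e * c e ≤ T ∧ ∀ M : Finset E, G.IsMatching M → (M.card : ℝ) ≤ T + ∑ e ∈ M, z e := by
  classical
  obtain ⟨z, hz0, hz⟩ := exists_prices_of_convexHull G.finite_matchingVectors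
    G.zero_mem_matchingVectors (c := G.edgeSet.indicator c) (T := T)
    (Set.indicator_nonneg hc) (by
      intro x hx hxc
      obtain ⟨h1, h2, h3, h4⟩ := convexHull_matchingVectors_subset hx
      refine (le_min ?_ h4).trans_lt hT
      have h5 : ∑ e, x e = ∑ e with e ∈ G.edgeSet, x e := by
        rw [Finset.sum_filter]
        exact Finset.sum_congr rfl fun e _ => by
          split_ifs with he
          · rfl
          · exact h3 e he
      rw [h5]
      refine le_capMatchingNumber h1 (fun e he => ?_) h2
      simpa [he] using hxc e)
  have hzM : ∀ M : Finset E, G.IsMatching M →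
      (M.card : ℝ) + ∑ e, z e * G.edgeSet.indicator c e ≤ T + ∑ e ∈ M, z e := by
    intro M hM
    have h := hz _ ⟨M, hM, rfl⟩
    have h1 := sum_mul_indicator (fun _ => (1 : ℝ)) M
    simp only [one_mul, Finset.sum_const, nsmul_eq_mul, mul_one] at h1
    rwa [sum_mul_indicator, h1] at h
  have hzc0 : 0 ≤ ∑ e, z e * G.edgeSet.indicator c e :=
    Finset.sum_nonneg fun e _ => mul_nonneg (hz0 e) (Set.indicator_nonneg hc e)
  refine ⟨G.edgeSet.indicator fun e => min (z e) 1,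
    fun e => Set.indicator_nonneg (fun e _ => le_min (hz0 e) zero_le_one) e,
    fun e => Set.indicator_le' (fun e _ => min_le_right _ _) (fun e _ => zero_le_one) e,
    fun e he => Set.indicator_of_notMem he _, ?_, fun M hM => ?_⟩
  · have h := hzM ∅ isMatching_empty
    simp only [Finset.card_empty, Nat.cast_zero, zero_add, Finset.sum_empty, add_zero] at h
    refine le_trans (Finset.sum_le_sum fun e _ => ?_) h
    by_cases he : e ∈ G.edgeSet
    · simp only [Set.indicator_of_mem he]
      exact mul_le_mul_of_nonneg_right (min_le_left _ _) (hc e he)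
    · simp [Set.indicator_of_notMem he]
  -- Edges priced above 1 pay for themselves once truncated to price 1, so the bound is only needed
  -- for the remaining edges.
  · have h := hzM _ (hM.subset (Finset.filter_subset (fun e => z e ≤ 1) M))
    rw [← Finset.card_filter_add_card_filter_not (s := M) fun e => z e ≤ 1,
      ← Finset.sum_filter_add_sum_filter_not M fun e => z e ≤ 1]
    have h1 : ∑ e ∈ M with z e ≤ 1, G.edgeSet.indicator (fun e => min (z e) 1) e =
        ∑ e ∈ M with z e ≤ 1, z e := by
      refine Finset.sum_congr rfl fun e he => ?_
      rw [Finset.mem_filter] at he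
      rw [Set.indicator_of_mem (hM.1 he.1), min_eq_left he.2]
    have h2 : ∑ e ∈ M with ¬ z e ≤ 1, G.edgeSet.indicator (fun e => min (z e) 1) e =
        (M.filter fun e => ¬ z e ≤ 1).card := by
      rw [Finset.card_eq_sum_ones, Nat.cast_sum]
      refine Finset.sum_congr rfl fun e he => ?_
      rw [Finset.mem_filter] at he
      rw [Set.indicator_of_mem (hM.1 he.1), min_eq_right (not_le.1 he.2).le, Nat.cast_one]
    rw [h1, h2]
    push_cast
    linarith

end Graph

/-! ### Chernoff bound -/

/-- The convex function exp lies below its chord between 0 and `l`. -/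
theorem Real.exp_mul_le_one_add_mul {l z : ℝ} (h0 : 0 ≤ z) (h1 : z ≤ 1) :
    Real.exp (l * z) ≤ 1 + z * (Real.exp l - 1) := by
  have h := convexOn_exp.2 (Set.mem_univ 0) (Set.mem_univ l) (sub_nonneg.2 h1) h0 (by ring)
  simp only [smul_eq_mul, mul_zero, zero_add, Real.exp_zero, mul_one] at h
  rw [mul_comm l]
  linarith

open MeasureTheory ProbabilityTheory in
/-- A Chernoff bound for weighted sums of independent coin flips. -/
theorem measureReal_pi_bernoulli_le_sum {E : Type*} [Fintype E] (p : E → unitInterval) {z : E → ℝ}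
    (hz0 : ∀ e, 0 ≤ z e) (hz1 : ∀ e, z e ≤ 1) {l : ℝ} (hl : 0 ≤ l) (t : ℝ) :
    (Measure.pi fun e => bernoulliMeasure true false (p e)).real
        {ω : E → Bool | t ≤ ∑ e with ω e = true, z e} ≤
      Real.exp ((Real.exp l - 1) * ∑ e, (p e : ℝ) * z e - l * t) := by
  set P := Measure.pi fun e => bernoulliMeasure true false (p e)
  let g : E → Bool → ℝ := fun e b => Real.exp (if b = true then l * z e else 0)
  have hg : ∀ ω : E → Bool, ∏ e, g e (ω e) = Real.exp (l * ∑ e with ω e = true, z e) := by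
    intro ω
    rw [← Real.exp_sum, Finset.sum_filter, Finset.mul_sum]
    congr 1
    exact Finset.sum_congr rfl fun e _ => by split_ifs <;> simp
  have hint : Integrable (fun ω : E → Bool => ∏ e, g e (ω e)) P := Integrable.of_finite
  have hmarkov := mul_meas_ge_le_integral_of_nonneg (μ := P) (f := fun ω => ∏ e, g e (ω e))
    (Filter.Eventually.of_forall fun ω => Finset.prod_nonneg fun e _ => (Real.exp_pos _).le)
    hint (Real.exp (l * t))
  rw [integral_fintype_prod_eq_prod] at hmarkov
  have hprod : ∏ e, ∫ b, g e b ∂(bernoulliMeasure true false (p e)) ≤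
      Real.exp ((Real.exp l - 1) * ∑ e, (p e : ℝ) * z e) := by
    rw [Finset.mul_sum, Real.exp_sum]
    refine Finset.prod_le_prod (fun e _ => integral_nonneg fun b => (Real.exp_pos _).le)
      fun e _ => ?_
    rw [integral_bernoulliMeasure]
    simp only [g, if_true, Bool.false_eq_true, if_false, Real.exp_zero, smul_eq_mul, mul_one]
    refine le_trans ?_ (Real.add_one_le_exp _)
    have h1 := mul_le_mul_of_nonneg_left (Real.exp_mul_le_one_add_mul (l := l) (hz0 e) (hz1 e))
      (p e).2.1
    linarith
  have hsub : {ω : E → Bool | t ≤ ∑ e with ω e = true, z e} ⊆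
      {ω | Real.exp (l * t) ≤ ∏ e, g e (ω e)} := by
    intro ω hω
    simp only [Set.mem_ofPred_eq] at hω ⊢
    rw [hg, Real.exp_le_exp]
    exact mul_le_mul_of_nonneg_left hω hl
  rw [Real.exp_sub, le_div_iff₀ (Real.exp_pos _), mul_comm]
  exact (mul_le_mul_of_nonneg_left (measureReal_mono hsub) (Real.exp_pos _).le).trans
    (hmarkov.trans hprod)

/-! ### Sampling parameters and numerical estimates -/

namespace Graph

variable {V E : Type*} {G : Graph V E}

theorem capMatchingNumber_nonneg [Fintype E] (G : Graph V E) (c : E → ℝ) :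
    0 ≤ G.capMatchingNumber c := by
  classical
  refine Real.sSup_nonneg ?_
  rintro _ ⟨x, hx, -, -, rfl⟩
  exact Finset.sum_nonneg fun e he => hx.nonneg e (Finset.mem_filter.1 he).2

theorem sampled_induce_restrict_le (G : Graph V E) (ω : E → Bool) (W : Set V) (F : Set E) :
    ((G.sampled ω).induce W).restrict F ≤ (G.induce W).restrict F :=
  ⟨le_rfl, fun _ _ _ h => ⟨h.1, h.2.1.2, h.2.2⟩⟩

theorem eq_true_of_mem_edgeSet_sampled {ω : E → Bool} {W : Set V} {F : Set E} {e : E}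
    (he : e ∈ (((G.sampled ω).induce W).restrict F).edgeSet) : ω e = true := by
  obtain ⟨u, v, -, h, -⟩ := exists_isLink_of_mem_edgeSet he
  exact h.1

theorem two_le_order [Finite V] [Fintype E] [G.Loopless] (h : 0 < G.matchingNumber) :
    2 ≤ G.order := by
  obtain ⟨M, hM, hcard⟩ := G.exists_isMatching_card_eq_matchingNumber
  obtain ⟨e, he⟩ := Finset.card_pos.1 (hcard ▸ h)
  exact (Set.one_lt_ncard_iff_nontrivial).2
    (vertexSet_nontrivial_of_edgeSet_nonempty_of_loopless ⟨e, hM.1 he⟩)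

theorem rhoParam_mul_exp (G : Graph V E) (ε : ℝ) :
    G.rhoParam ε * Real.exp (20 * Real.log 2 / ε ^ 2) = G.alphaParam ε := by
  have h : Real.exp (20 * Real.log 2 / ε ^ 2) = (2 : ℝ) ^ (20 / ε ^ 2) := by
    rw [Real.rpow_def_of_pos two_pos]
    congr 1
    ring
  rw [h, rhoParam, alphaParam, mul_assoc, ← Real.rpow_add two_pos]
  congr 2
  ring

theorem samplingProb_le {κ : E → ℝ} {ε : ℝ} {e : E} (h : 0 ≤ κ e * G.rhoParam ε) :
    (G.samplingProb κ ε e : ℝ) ≤ κ e * G.rhoParam ε := by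
  rw [samplingProb, Set.coe_projIcc]
  exact max_le h (min_le_right _ _)

end Graph

/-- Tangent line of log at 5/2, together with 5/2 < e. -/
theorem two_mul_log_le (x : ℝ) (hx : 0 < x) : 2 * Real.log x ≤ 4 / 5 * x := by
  have h := Real.log_le_sub_one_of_pos (x := x / (5 / 2)) (by positivity)
  have h2 : Real.log (5 / 2) ≤ 1 := by
    rw [Real.log_le_iff_le_exp (by norm_num)]
    linarith [Real.exp_one_gt_d9]
  rw [Real.log_div hx.ne' (by norm_num)] at h
  linarith

/-- The union bound over the `2 ^ n` vertex sets leaves a failure probability of at most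
`min (exp (-m)) (n ^ (-2))`. -/
theorem two_pow_mul_exp_le {n : ℕ} {m ε : ℝ} (hn : 2 ≤ n) (hm : 0 < m) (hε0 : 0 < ε) (hε1 : ε < 1)
    (hnm : ε * n / 16 ≤ m) :
    2 ^ n * Real.exp (11 / 10 * m - 20 * Real.log 2 / ε ^ 2 * (19 / 10 * ε * m)) ≤
      min (Real.exp (-m)) (1 / (n : ℝ) ^ 2) := by
  have hn0 : (0 : ℝ) < n := by positivity
  set a := m / ε with ha
  have hma : m ≤ a := by rw [ha, le_div_iff₀ hε0]; nlinarith
  have hna : (n : ℝ) ≤ 16 * a := by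
    rw [ha, ← mul_div_assoc, le_div_iff₀ hε0]; linarith
  have h1 : 20 * Real.log 2 / ε ^ 2 * (19 / 10 * ε * m) = 38 * Real.log 2 * a := by
    rw [ha]; field_simp; ring
  have hlog : (69 / 100 : ℝ) < Real.log 2 := by linarith [Real.log_two_gt_d9]
  have h2 : (2 : ℝ) ^ n = Real.exp (n * Real.log 2) := by
    rw [mul_comm, Real.exp_mul, Real.exp_log two_pos, Real.rpow_natCast]
  have h3 : 1 / (n : ℝ) ^ 2 = Real.exp (-(2 * Real.log n)) := by
    rw [Real.exp_neg, two_mul, Real.exp_add, Real.exp_log hn0, ← sq, one_div]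
  have h4 : (n : ℝ) * Real.log 2 ≤ 16 * a * Real.log 2 :=
    mul_le_mul_of_nonneg_right hna (by linarith)
  have h5 : 69 / 100 * a ≤ Real.log 2 * a :=
    mul_le_mul_of_nonneg_right hlog.le (by linarith)
  have h6 := two_mul_log_le n hn0
  rw [h1, h2, h3, ← Real.exp_add]
  -- The exponent is at most (1.1 - 22 · 0.69) a < -14 a, while m ≤ a and 2 log n ≤ 0.8 n ≤ 12.8 a.
  refine le_min (Real.exp_le_exp.2 ?_) (Real.exp_le_exp.2 ?_) <;> linarith

/-! ### The union bound over vertex sets -/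

open MeasureTheory in
theorem mainTheorem6 {V E : Type*} [Fintype V] [Fintype E] (G : Graph V E) [G.Loopless]
    (ε : ℝ) (hε0 : 0 < ε) (hε1 : ε < 1)
    (hμ : ε * (G.order : ℝ) / 16 ≤ (G.matchingNumber : ℝ))
    (κ : E → ℝ) (hκ0 : ∀ e ∈ G.edgeSet, 0 ≤ κ e)
    (hκ1 : ∀ e ∈ G.edgeSet, κ e ≤ 1 / G.alphaParam ε) :
    max (1 - Real.exp (-(G.matchingNumber : ℝ))) (1 - 1 / (G.order : ℝ) ^ 2) ≤
      (G.samplingMeasure κ ε).real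
        {ω | ∀ W : Set V, W ⊆ G.vertexSet →
          ((((G.sampled ω).induce W).restrict (G.lowEdges κ ε)).matchingNumber : ℝ) ≤
            ((G.induce W).restrict (G.lowEdges κ ε)).capMatchingNumber (G.capPlus κ ε) +
              2 * ε * (G.matchingNumber : ℝ)} := by
  classical
  have hprob : IsProbabilityMeasure (G.samplingMeasure κ ε) := by
    unfold Graph.samplingMeasure; infer_instance
  set A := {ω : E → Bool | ∀ W : Set V, W ⊆ G.vertexSet →
          ((((G.sampled ω).induce W).restrict (G.lowEdges κ ε)).matchingNumber : ℝ) ≤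
            ((G.induce W).restrict (G.lowEdges κ ε)).capMatchingNumber (G.capPlus κ ε) +
              2 * ε * (G.matchingNumber : ℝ)} with hA
  have hle : ∀ W : Set V, W ⊆ G.vertexSet → (G.induce W).restrict (G.lowEdges κ ε) ≤ G :=
    fun W hW => le_trans Graph.restrict_le (Graph.induce_le hW)
  -- Without edges the event is certain; otherwise n ≥ 2, which makes log n, α and ρ positive.
  rcases Nat.eq_zero_or_pos G.matchingNumber with h0 | hpos
  · have hAuniv : A = Set.univ := by
      refine Set.eq_univ_of_forall fun ω W hW => ?_
      have h1 := Graph.matchingNumber_mono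
        ((G.sampled_induce_restrict_le ω W (G.lowEdges κ ε)).trans (hle W hW))
      rw [h0, Nat.le_zero] at h1
      rw [h1, h0]
      simpa using Graph.capMatchingNumber_nonneg _ _
    rw [hAuniv, probReal_univ]
    refine max_le ?_ ?_
    · linarith [Real.exp_pos (-(G.matchingNumber : ℝ))]
    · have : (0 : ℝ) ≤ 1 / (G.order : ℝ) ^ 2 := by positivity
      linarith
  have hm : (0 : ℝ) < G.matchingNumber := by exact_mod_cast hpos
  have hn := Graph.two_le_order hpos
  set m : ℝ := (G.matchingNumber : ℝ) with hmdef
  have hlogb : 0 < Real.logb 2 (G.order : ℝ) :=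
    Real.logb_pos one_lt_two (by exact_mod_cast hn)
  have hα : 0 < G.alphaParam ε := mul_pos hlogb (by positivity)
  have hρ : 0 < G.rhoParam ε := mul_pos hlogb (by positivity)
  let H : Set V → Graph V E := fun W => (G.induce W).restrict (G.lowEdges κ ε)
  -- The minimum makes T ≤ 11/10 m immediate; the slack gives a strict inequality, and 1/10 + 19/10
  -- = 2 matches `t`.
  let T : Set V → ℝ := fun W =>
    min ((H W).capMatchingNumber (G.capPlus κ ε)) (H W).matchingNumber + ε * m / 10
  have hcap : ∀ W, ∀ e ∈ (H W).edgeSet, G.capPlus κ ε e = κ e * G.alphaParam ε :=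
    fun W e he => if_pos he.2
  have hκH : ∀ W ⊆ G.vertexSet, ∀ e ∈ (H W).edgeSet, 0 ≤ κ e :=
    fun W hW e he => hκ0 e ((hle W hW).edgeSet_mono he)
  have hprices : ∀ W : Set V, W ⊆ G.vertexSet → ∃ z : E → ℝ, (∀ e, 0 ≤ z e) ∧ (∀ e, z e ≤ 1) ∧
      (∀ e ∉ (H W).edgeSet, z e = 0) ∧ ∑ e, z e * G.capPlus κ ε e ≤ T W ∧
      ∀ M : Finset E, (H W).IsMatching M → (M.card : ℝ) ≤ T W + ∑ e ∈ M, z e := by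
    intro W hW
    have : (H W).Loopless := Graph.Loopless.anti (hle W hW)
    refine Graph.exists_prices (fun e he => ?_) (lt_add_of_pos_right _ (by positivity))
    rw [hcap W e he]
    exact mul_nonneg (hκH W hW e he) hα.le
  choose! z hz0 hz1 hzH hzc hzM using hprices
  -- Chosen so that e^l = α/ρ, which turns sampling probabilities into κ⁺.
  set l := 20 * Real.log 2 / ε ^ 2 with hl
  have hl0 : 0 ≤ l := div_nonneg (mul_nonneg (by norm_num) (Real.log_nonneg one_le_two)) (sq_nonneg ε)
  set t := 19 / 10 * ε * m with ht
  let B : Set V → Set (E → Bool) := fun W => {ω | t ≤ ∑ e with ω e = true, z W e}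
  have hB : ∀ W ⊆ G.vertexSet,
      (G.samplingMeasure κ ε).real (B W) ≤ Real.exp (11 / 10 * m - l * t) := by
    intro W hW
    refine (measureReal_pi_bernoulli_le_sum _ (hz0 W hW) (hz1 W hW) hl0 t).trans
      (Real.exp_le_exp.2 (sub_le_sub_right ?_ _))
    have hpz : ∀ e, Real.exp l * ((G.samplingProb κ ε e : ℝ) * z W e) ≤
        z W e * G.capPlus κ ε e := by
      intro e
      by_cases he : e ∈ (H W).edgeSet
      · rw [hcap W e he, ← G.rhoParam_mul_exp ε, ← hl]
        have h1 := Graph.samplingProb_le (mul_nonneg (hκH W hW e he) hρ.le)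
        have h2 := mul_le_mul_of_nonneg_left h1 (mul_nonneg (Real.exp_pos l).le (hz0 W hW e))
        linarith
      · simp [hzH W hW e he]
    have hT : T W ≤ 11 / 10 * m := by
      have h1 : ((H W).matchingNumber : ℝ) ≤ m :=
        Nat.cast_le.2 (Graph.matchingNumber_mono (hle W hW))
      have h2 : ε * m ≤ 1 * m := mul_le_mul_of_nonneg_right hε1.le hm.le
      have h3 := min_le_right ((H W).capMatchingNumber (G.capPlus κ ε)) ((H W).matchingNumber : ℝ)
      simp only [T]
      linarith
    have hsum0 : 0 ≤ ∑ e, (G.samplingProb κ ε e : ℝ) * z W e :=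
      Finset.sum_nonneg fun e _ => mul_nonneg (G.samplingProb κ ε e).2.1 (hz0 W hW e)
    calc (Real.exp l - 1) * ∑ e, (G.samplingProb κ ε e : ℝ) * z W e
        ≤ Real.exp l * ∑ e, (G.samplingProb κ ε e : ℝ) * z W e :=
          mul_le_mul_of_nonneg_right (by linarith) hsum0
      _ ≤ ∑ e, z W e * G.capPlus κ ε e := by
          rw [Finset.mul_sum]
          exact Finset.sum_le_sum fun e _ => hpz e
      _ ≤ 11 / 10 * m := (hzc W hW).trans hT
  have hfin : G.vertexSet.Finite := Set.toFinite _
  have hsub : Aᶜ ⊆ ⋃ X ∈ hfin.toFinset.powerset, B (X : Set V) := by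
    intro ω hω
    rw [hA] at hω
    simp only [Set.mem_compl_iff, Set.mem_ofPred_eq, not_forall, not_le] at hω
    obtain ⟨W, hW, hlt⟩ := hω
    have hWfin : W.Finite := Set.toFinite _
    simp only [Set.mem_iUnion]
    refine ⟨hWfin.toFinset, by simpa using hW, ?_⟩
    rw [Set.Finite.coe_toFinset]
    obtain ⟨M, hM, hcard⟩ :=
      (((G.sampled ω).induce W).restrict (G.lowEdges κ ε)).exists_isMatching_card_eq_matchingNumber
    rw [← hcard] at hlt
    have h1 := hzM W hW M (hM.mono (G.sampled_induce_restrict_le ω W _))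
    have h2 : ∑ e ∈ M, z W e ≤ ∑ e with ω e = true, z W e :=
      Finset.sum_le_sum_of_subset_of_nonneg
        (fun e he => Finset.mem_filter.2 ⟨Finset.mem_univ e,
          Graph.eq_true_of_mem_edgeSet_sampled (hM.1 he)⟩)
        fun e _ _ => hz0 W hW e
    have h3 := min_le_left ((H W).capMatchingNumber (G.capPlus κ ε)) ((H W).matchingNumber : ℝ)
    simp only [B, Set.mem_ofPred_eq, ht]
    simp only [T] at h1
    simp only [H] at h1 h3
    linarith
  have hfail : (G.samplingMeasure κ ε).real Aᶜ ≤ min (Real.exp (-m)) (1 / (G.order : ℝ) ^ 2) := by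
    refine le_trans ?_ (two_pow_mul_exp_le hn hm hε0 hε1 hμ)
    calc (G.samplingMeasure κ ε).real Aᶜ
        ≤ (G.samplingMeasure κ ε).real (⋃ X ∈ hfin.toFinset.powerset, B (X : Set V)) :=
          measureReal_mono hsub (measure_ne_top _ _)
      _ ≤ ∑ X ∈ hfin.toFinset.powerset, (G.samplingMeasure κ ε).real (B (X : Set V)) :=
          measureReal_biUnion_finset_le _ _
      _ ≤ ∑ X ∈ hfin.toFinset.powerset, Real.exp (11 / 10 * m - l * t) :=
          Finset.sum_le_sum fun X hX => hB _ (by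
            intro v hv
            exact hfin.mem_toFinset.1 (Finset.mem_powerset.1 hX hv))
      _ = 2 ^ G.order * Real.exp (11 / 10 * m - l * t) := by
          rw [Finset.sum_const, Finset.card_powerset, nsmul_eq_mul, Graph.order,
            Set.ncard_eq_toFinset_card _ hfin]
          push_cast
          rfl
  have hcompl := probReal_add_probReal_compl (μ := G.samplingMeasure κ ε)
    (s := A) (Set.toFinite A).measurableSet
  exact max_le (by linarith [hfail.trans (min_le_left _ _)])
    (by linarith [hfail.trans (min_le_right _ _)])
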